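/- Let $d \ge 0$ be an integer, let $[d+1] = \{1,\dots,d+1\}$, let $\Delta_d = \{x \in \mathbb{R}^{d+1} : \sum_i x_i = 1,\ x_i \ge 0 \text{ for all } i\}$ be the $d$-simplex, and let $S(d)$ be the set of row-stochastic real $(d+1)\times(d+1)$ matrices, that is, matrices with non-negative entries in which every row sums to one. Let $f \colon \Delta_d \to S(d)$ be continuous, and write $f_{ij}(x)$ for the $(i,j)$ entry of $f(x)$. Then there exist $x \in \Delta_d$ and a permutation $\pi$ of $[d+1]$ such that $$f_{i\pi(i)}(x) \le x_{\pi(i)} \quad \text{for all } i \in [d+1].$$ This reduces to Brouwer's fixed point theorem when all rows are equal: if there is a map $h \colon \Delta_d \to \Delta_d$ such that every row of $f(x)$ equals $h(x)$, for every $x \in \Delta_d$, then for each $x \in \Delta_d$ a permutation $\pi$ with $f_{i\pi(i)}(x) \le x_{\pi(i)}$ for all $i$ exists if and only if $h(x) = x$; in particular, $h$ has a fixed point. -/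

import Mathlib

/-! Fix ε > 0 and clip the excess `(1 + ε) x_j - f_ij(x)` at zero. Unclipped, each row adds up to ε,
so the clipped rows have positive sums and can be normalised to a stochastic matrix M(x). The
entries of M(x) total d + 1, so some column sum is at most 1: the closed sets "column j sums to at
most 1" cover the simplex. The dual KKM theorem gives x at which this holds for every j with `x_j >
0`; if `x_j = 0`, column j vanishes because f ≥ 0. All column sums are then at most 1, hence equal
to 1, and Birkhoff's theorem gives a permutation in the support of M(x), along which `f_ij < (1 + ε)
x_j ≤ x_j + ε`. Compactness removes ε.

KKM comes from Scarf's lemma. Colour a fine finite set of points by a closed set containing each,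
and rank the points by their coordinates. A dominant set showing all colours, with slack points
standing for absent ones, has small diameter, so any of its points approximately solves the problem.
Scarf's lemma is a parity count resting on `Dominant.card_extensions` and
`even_card_filter_image_erase`. -/

/-! ### Dominant sets and their one-point extensions -/

/-- A finite set is dominant for a family of rank functions if every point is, for some index,
ranked no higher than all elements of the set. -/
def Dominant {X I : Type*} (r : I → X → ℕ) (s : Finset X) : Prop :=
  ∀ y, ∃ i, ∀ x ∈ s, r i y ≤ r i x

/-- The points ranked strictly above the minimum of `t` for every index other than `k`. -/
def AboveExcept {X I : Type*} (r : I → X → ℕ) (t : Finset X) (k : I) (y : X) : Prop :=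
  ∀ l, l ≠ k → ∃ x ∈ t, r l x < r l y

theorem Dominant.mono {X I : Type*} {r : I → X → ℕ} {s t : Finset X} (hs : Dominant r s)
    (h : t ⊆ s) : Dominant r t := fun y =>
  (hs y).imp fun _ hi x hx => hi x (h hx)

/-- The point is the candidate ranked highest for `k`. Anything above all minima of the enlarged set
would be a higher candidate or contradict dominance of `t`; conversely, dominance of an extension by
a lower candidate fails at the highest one. -/
theorem Dominant.existsUnique_insert {X I : Type*} [Fintype X] [DecidableEq X] {r : I → X → ℕ}
    (hr : ∀ i, Function.Injective (r i)) {t : Finset X} (ht : Dominant r t) {k : I}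
    (hne : ∃ y, AboveExcept r t k y) :
    ∃! y, AboveExcept r t k y ∧ Dominant r (insert y t) := by
  classical
  obtain ⟨y₀, h₀⟩ := hne
  obtain ⟨y, hy, hmax⟩ := Finset.exists_max_image
    (Finset.univ.filter (AboveExcept r t k)) (r k) ⟨y₀, by simpa using h₀⟩
  simp only [Finset.mem_filter, Finset.mem_univ, true_and] at hy hmax
  refine ⟨y, ⟨hy, ?_⟩, ?_⟩
  · intro z
    by_contra! hz
    have hzk : AboveExcept r t k z := by
      intro l hl
      obtain ⟨x, hx, hxz⟩ := hz l
      rcases Finset.mem_insert.1 hx with rfl | hx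
      · obtain ⟨w, hw, hwx⟩ := hy l hl
        exact ⟨w, hw, hwx.trans hxz⟩
      · exact ⟨x, hx, hxz⟩
    obtain ⟨x, hx, hxz⟩ := hz k
    rcases Finset.mem_insert.1 hx with rfl | hx
    · exact absurd (hmax z hzk) (not_le.2 hxz)
    · obtain ⟨l, hl⟩ := ht z
      by_cases hlk : l = k
      · subst hlk; exact absurd (hl x hx) (not_le.2 hxz)
      · obtain ⟨w, hw, hwz⟩ := hzk l hlk
        exact absurd (hl w hw) (not_le.2 hwz)
  · rintro y' ⟨hy', hd⟩
    obtain ⟨l, hl⟩ := hd y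
    by_cases hlk : l = k
    · subst hlk
      exact hr l (le_antisymm (hmax y' hy') (hl y' (Finset.mem_insert_self _ _)))
    · obtain ⟨w, hw, hwy⟩ := hy l hlk
      exact absurd (hl w (Finset.mem_insert_of_mem hw)) (not_le.2 hwy)

/-- Dominance applied to an element of `s` itself shows that it is the minimum for some index, so
the minimizer map is onto `s`. -/
theorem Dominant.exists_minimizer {X I : Type*} {r : I → X → ℕ} {s : Finset X}
    (hr : ∀ i, Function.Injective (r i)) (hs : Dominant r s) (hne : s.Nonempty) :
    ∃ μ : I → X, (∀ i, μ i ∈ s) ∧ (∀ i, ∀ x ∈ s, r i (μ i) ≤ r i x) ∧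
      ∀ x ∈ s, ∃ i, μ i = x := by
  choose μ hμ hmin using fun i => Finset.exists_min_image s (r i) hne
  refine ⟨μ, hμ, hmin, fun x hx => ?_⟩
  obtain ⟨i, hi⟩ := hs x
  exact ⟨i, hr i (le_antisymm (hmin i x hx) (hi _ (hμ i)))⟩

/-- A dominant set with one element less than the number of indices, and above whose minima
there is always room, extends to a dominant set in exactly two ways. -/
theorem Dominant.card_extensions {X I : Type*} [Fintype X] [DecidableEq X] [Fintype I]
    {r : I → X → ℕ} (hr : ∀ i, Function.Injective (r i)) {t : Finset X} (ht : Dominant r t)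
    (hne : t.Nonempty) (hcard : t.card + 1 = Fintype.card I)
    (habove : ∀ k, ∃ y, AboveExcept r t k y) [DecidablePred fun y => y ∉ t ∧ Dominant r (insert y t)] :
    (Finset.univ.filter fun y => y ∉ t ∧ Dominant r (insert y t)).card = 2 := by
  classical
  obtain ⟨μ, hμ, hmin, hsurj⟩ := ht.exists_minimizer hr hne
  -- There is one index more than elements, so two indices share a minimizer. Freeing `i` or freeing
  -- `j` gives the two extensions.
  obtain ⟨i, -, j, -, hij, hμij⟩ := Finset.exists_ne_map_eq_of_card_lt_of_maps_to
    (s := (Finset.univ : Finset I)) (t := t) (f := μ) (by rw [Finset.card_univ]; omega)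
    (fun i _ => hμ i)
  obtain ⟨y, ⟨hy, hyd⟩, hyu⟩ := ht.existsUnique_insert hr (habove i)
  obtain ⟨z, ⟨hz, hzd⟩, hzu⟩ := ht.existsUnique_insert hr (habove j)
  have hkey : ∀ k, (k = i ∨ k = j) → ∀ x, AboveExcept r t k x → x ∉ t := by
    intro k hk x hx hxt
    obtain ⟨l, hlk, hl⟩ : ∃ l, l ≠ k ∧ μ l = x := by
      obtain ⟨l, hl⟩ := hsurj x hxt
      by_cases hlk : l = k
      · rcases hk with rfl | rfl
        · exact ⟨j, hij.symm, by rw [← hμij, ← hlk, hl]⟩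
        · exact ⟨i, hij, by rw [hμij, ← hlk, hl]⟩
      · exact ⟨l, hlk, hl⟩
    obtain ⟨w, hw, hwx⟩ := hx l hlk
    exact absurd (hmin l w hw) (by rw [hl]; exact not_le.2 hwx)
  have hyz : y ≠ z := by
    rintro rfl
    obtain ⟨l, hl⟩ := ht y
    by_cases hli : l = i
    · obtain ⟨w, hw, hwy⟩ := hz l (hli ▸ hij)
      exact absurd (hl w hw) (not_le.2 hwy)
    · obtain ⟨w, hw, hwy⟩ := hy l hli
      exact absurd (hl w hw) (not_le.2 hwy)
  rw [Finset.card_eq_two]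
  refine ⟨y, z, hyz, ?_⟩
  ext x
  simp only [Finset.mem_filter, Finset.mem_univ, true_and, Finset.mem_insert,
    Finset.mem_singleton]
  constructor
  · rintro ⟨hxt, hxd⟩
    obtain ⟨ν, hν, hνmin, hνsurj⟩ := hxd.exists_minimizer hr (Finset.insert_nonempty _ _)
    have hinj : Set.InjOn ν (Finset.univ : Finset I) := by
      apply Finset.injOn_of_surjOn_of_card_le (t := insert x t)
      · intro a _; exact hν a
      · intro a ha
        obtain ⟨l, hl⟩ := hνsurj a ha
        exact ⟨l, by simp, hl⟩
      · rw [Finset.card_insert_of_notMem hxt, Finset.card_univ, hcard]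
    obtain ⟨k, hk⟩ := hνsurj x (Finset.mem_insert_self _ _)
    have hνt : ∀ l, l ≠ k → ν l ∈ t := by
      intro l hl
      rcases Finset.mem_insert.1 (hν l) with h | h
      · exact absurd (hinj (by simp) (by simp) (h.trans hk.symm)) hl
      · exact h
    have hνμ : ∀ l, l ≠ k → ν l = μ l := fun l hl => hr l
      (le_antisymm (hνmin l _ (Finset.mem_insert_of_mem (hμ l))) (hmin l _ (hνt l hl)))
    have hxk : AboveExcept r t k x := fun l hl => ⟨ν l, hνt l hl,
      lt_of_le_of_ne (hνmin l x (Finset.mem_insert_self _ _))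
        fun h => hxt (hr l h ▸ hνt l hl)⟩
    -- The new point is the minimum for `k` alone, and the other minimizers stay distinct, so `k`
    -- must split the pair `i`, `j`.
    by_cases hki : k = i
    · subst hki; exact Or.inl (hyu x ⟨hxk, hxd⟩)
    by_cases hkj : k = j
    · subst hkj; exact Or.inr (hzu x ⟨hxk, hxd⟩)
    exact absurd (hinj (by simp) (by simp)
      (((hνμ i (Ne.symm hki)).trans hμij).trans (hνμ j (Ne.symm hkj)).symm)) hij
  · rintro (rfl | rfl)
    · exact ⟨hkey i (Or.inl rfl) _ hy, hyd⟩
    · exact ⟨hkey j (Or.inr rfl) _ hz, hzd⟩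

/-! ### Scarf's lemma by parity -/

/-- In a set whose elements do not show all colours, an even number of elements can be removed to
leave exactly the colours other than `i₀`, each once. -/
theorem even_card_filter_image_erase {X I : Type*} [DecidableEq X] [DecidableEq I] [Fintype I]
    (c : X → I) (i₀ : I) (s : Finset X) (hcard : s.card = Fintype.card I)
    (hs : s.image c ≠ Finset.univ) :
    Even (s.filter fun y => (s.erase y).image c = Finset.univ.erase i₀).card := by
  rcases (s.filter fun y => (s.erase y).image c = Finset.univ.erase i₀).eq_empty_or_nonempty
    with h | ⟨y₀, hy₀⟩
  · rw [h]; exact ⟨0, rfl⟩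
  rw [Finset.mem_filter] at hy₀
  obtain ⟨hy₀s, hy₀⟩ := hy₀
  have hinj : Set.InjOn c (s.erase y₀) := by
    rw [← Finset.card_image_iff, hy₀, Finset.card_erase_of_mem (Finset.mem_univ _),
      Finset.card_erase_of_mem hy₀s, hcard, Finset.card_univ]
  have himage : s.image c = insert (c y₀) (Finset.univ.erase i₀) := by
    rw [← hy₀, ← Finset.image_insert, Finset.insert_erase hy₀s]
  have hc₀ : c y₀ ≠ i₀ := by
    intro h
    apply hs
    rw [himage, h, Finset.insert_erase (Finset.mem_univ _)]
  have himage' : s.image c = Finset.univ.erase i₀ := by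
    rw [himage, Finset.insert_eq_self.2 (by simpa using hc₀)]
  have : c y₀ ∈ (s.erase y₀).image c := by rw [hy₀]; simpa using hc₀
  -- `y₁` is the other element with the colour of `y₀`; these two are the only removable ones.
  obtain ⟨y₁, hy₁, hc₁⟩ := Finset.mem_image.1 this
  have hne := Finset.ne_of_mem_erase hy₁
  have hy₁s := Finset.mem_of_mem_erase hy₁
  have : (s.filter fun y => (s.erase y).image c = Finset.univ.erase i₀) = {y₀, y₁} := by
    ext y
    simp only [Finset.mem_filter, Finset.mem_insert, Finset.mem_singleton]
    constructor
    · rintro ⟨hys, hy⟩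
      by_contra! hcon
      have hyc : c y ∈ (s.erase y).image c := by
        rw [hy, ← himage']; exact Finset.mem_image_of_mem _ hys
      obtain ⟨z, hz, hzc⟩ := Finset.mem_image.1 hyc
      have hye : y ∈ s.erase y₀ := Finset.mem_erase.2 ⟨hcon.1, hys⟩
      by_cases hz₀ : z = y₀
      · subst hz₀
        exact hcon.2 (hinj hye hy₁ (by rw [hc₁, hzc]))
      · exact Finset.ne_of_mem_erase hz
          (hinj (Finset.mem_erase.2 ⟨hz₀, Finset.mem_of_mem_erase hz⟩) hye hzc)
    · rintro (rfl | rfl)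
      · exact ⟨hy₀s, hy₀⟩
      · refine ⟨hy₁s, ?_⟩
        rw [← himage']
        apply Finset.Subset.antisymm (Finset.image_subset_image (Finset.erase_subset _ _))
        intro i hi
        obtain ⟨z, hz, rfl⟩ := Finset.mem_image.1 hi
        by_cases hzy : z = y
        · exact Finset.mem_image.2 ⟨y₀, Finset.mem_erase.2 ⟨hne.symm, hy₀s⟩, by rw [hzy, hc₁]⟩
        · exact Finset.mem_image_of_mem _ (Finset.mem_erase.2 ⟨hzy, hz⟩)
  rw [this, Finset.card_pair hne.symm]
  exact even_two

/-- Scarf's lemma in the presence of slack points: the index `i` itself is a point of colour `i`,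
lowest for `i` and above all genuine points for the other indices. -/
theorem exists_dominant_image_eq_univ {T I : Type*} [Fintype T] [DecidableEq T] [Nonempty T]
    [Fintype I] [DecidableEq I] [Nonempty I] (r : I → T ⊕ I → ℕ)
    (hr : ∀ i, Function.Injective (r i))
    (hlow : ∀ i x, r i (Sum.inr i) ≤ r i x)
    (hhigh : ∀ i j v, j ≠ i → r i (Sum.inl v) < r i (Sum.inr j)) (c : T → I) :
    ∃ s : Finset (T ⊕ I), Dominant r s ∧ s.image (Sum.elim c id) = Finset.univ := by
  classical
  by_contra! hcon
  obtain ⟨i₀⟩ := ‹Nonempty I›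
  set c' : T ⊕ I → I := Sum.elim c id with hc'
  -- The pairs in `P` are counted twice: grouped by `insert p.2 p.1` their number is even when no
  -- dominant set shows all colours; grouped by `p.1` it is odd.
  let P : Finset (Finset (T ⊕ I) × (T ⊕ I)) := Finset.univ.filter fun p =>
    p.2 ∉ p.1 ∧ (p.1.image c' = Finset.univ.erase i₀ ∧ p.1.card + 1 = Fintype.card I) ∧
      Dominant r (insert p.2 p.1)
  let D : Finset (Finset (T ⊕ I)) := Finset.univ.filter fun t =>
    (t.image c' = Finset.univ.erase i₀ ∧ t.card + 1 = Fintype.card I) ∧ Dominant r t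
  let R : Finset (Finset (T ⊕ I)) := Finset.univ.filter fun s =>
    s.card = Fintype.card I ∧ Dominant r s
  have heven : Even P.card := by
    rw [Finset.card_eq_sum_card_fiberwise (f := fun p => insert p.2 p.1) (t := R)]
    · apply Finset.even_sum
      intro s hs
      simp only [R, Finset.mem_filter, Finset.mem_univ, true_and] at hs
      refine (congrArg Even ?_).mpr (even_card_filter_image_erase c' i₀ s hs.1 (hcon s hs.2))
      refine Finset.card_bij' (fun p _ => p.2) (fun y _ => (s.erase y, y)) ?_ ?_ ?_ ?_
      · rintro ⟨t, y⟩ h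
        simp only [P, Finset.mem_filter, Finset.mem_univ, true_and] at h ⊢
        obtain ⟨⟨hyt, ⟨h1, -⟩, -⟩, rfl⟩ := h
        exact ⟨Finset.mem_insert_self _ _, by rw [Finset.erase_insert hyt]; exact h1⟩
      · intro y h
        simp only [P, Finset.mem_filter, Finset.mem_univ, true_and] at h ⊢
        rw [Finset.insert_erase h.1]
        exact ⟨⟨Finset.notMem_erase _ _, ⟨h.2, by rw [Finset.card_erase_add_one h.1, hs.1]⟩,
          hs.2⟩, rfl⟩
      · rintro ⟨t, y⟩ h
        simp only [P, Finset.mem_filter, Finset.mem_univ, true_and] at h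
        obtain ⟨⟨hyt, -, -⟩, rfl⟩ := h
        simp [Finset.erase_insert hyt]
      · intro y h
        rfl
    · rintro ⟨t, y⟩ h
      simp only [P, R, Finset.coe_filter, Finset.mem_univ, true_and, Set.mem_ofPred_eq] at h ⊢
      exact ⟨by rw [Finset.card_insert_of_notMem h.1, h.2.1.2], h.2.2⟩
  have hfib : ∀ t ∈ D, (P.filter fun p => p.1 = t).card =
      (Finset.univ.filter fun y => y ∉ t ∧ Dominant r (insert y t)).card := by
    intro t ht
    simp only [D, Finset.mem_filter, Finset.mem_univ, true_and] at ht
    refine Finset.card_bij' (fun p _ => p.2) (fun y _ => (t, y)) ?_ ?_ ?_ ?_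
    · rintro ⟨t', y⟩ h
      simp only [P, Finset.mem_filter, Finset.mem_univ, true_and] at h ⊢
      obtain ⟨⟨h1, -, h2⟩, rfl⟩ := h
      exact ⟨h1, h2⟩
    · intro y h
      simp only [P, Finset.mem_filter, Finset.mem_univ, true_and] at h ⊢
      exact ⟨⟨h.1, ht.1, h.2⟩, trivial⟩
    · rintro ⟨t', y⟩ h
      simp only [P, Finset.mem_filter, Finset.mem_univ, true_and] at h
      rw [h.2]
    · intro y h
      rfl
  -- The exceptional set: all slack points but `i₀`. Its only extension is by the genuine point
  -- ranked highest for `i₀`.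
  let t₀ : Finset (T ⊕ I) := (Finset.univ.erase i₀).image Sum.inr
  have hinr : ∀ i, Sum.inr i ∈ t₀ ↔ i ≠ i₀ := by intro i; simp [t₀]
  have hinl : ∀ v, Sum.inl v ∉ t₀ := by intro i; simp [t₀]
  obtain ⟨v, -, hv⟩ := Finset.exists_max_image (Finset.univ : Finset T)
    (fun v => r i₀ (Sum.inl v)) Finset.univ_nonempty
  have hext : (Finset.univ.filter fun y => y ∉ t₀ ∧ Dominant r (insert y t₀)) = {Sum.inl v} := by
    ext y
    simp only [Finset.mem_filter, Finset.mem_univ, true_and, Finset.mem_singleton]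
    constructor
    · rintro ⟨hy, hd⟩
      obtain ⟨i, hi⟩ := hd (Sum.inl v)
      have hii : i = i₀ := by
        by_contra h
        have h1 := hi (Sum.inr i) (Finset.mem_insert_of_mem ((hinr i).2 h))
        have h2 := hlow i (Sum.inl v)
        exact absurd (hr i (le_antisymm h1 h2)) (by simp)
      subst hii
      have h1 := hi y (Finset.mem_insert_self _ _)
      rcases y with w | j
      · exact hr i (le_antisymm (hv w (Finset.mem_univ _)) h1)
      · have hj : j = i := by
          by_contra h
          exact hy ((hinr j).2 h)
        subst hj
        exact absurd (hr j (le_antisymm h1 (hlow j _))) (by simp)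
    · rintro rfl
      refine ⟨hinl v, ?_⟩
      rintro (w | k)
      · refine ⟨i₀, fun x hx => ?_⟩
        rcases Finset.mem_insert.1 hx with rfl | hx
        · exact hv w (Finset.mem_univ _)
        · rcases x with x | j
          · exact absurd hx (hinl x)
          · exact (hhigh i₀ j w ((hinr j).1 hx)).le
      · exact ⟨k, fun x _ => hlow k x⟩
  have ht₀ : t₀ ∈ D := by
    simp only [D, Finset.mem_filter, Finset.mem_univ, true_and]
    refine ⟨⟨?_, ?_⟩, ?_⟩
    · ext i; simp [t₀, hc']
    · rw [Finset.card_image_of_injective _ Sum.inr_injective,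
        Finset.card_erase_add_one (Finset.mem_univ _), Finset.card_univ]
    · have : Sum.inl v ∈ Finset.univ.filter fun y => y ∉ t₀ ∧ Dominant r (insert y t₀) := by
        rw [hext]; exact Finset.mem_singleton_self _
      exact (Finset.mem_filter.1 this).2.2.mono (Finset.subset_insert _ _)
  have hodd : Odd P.card := by
    rw [Finset.card_eq_sum_card_fiberwise (f := fun p => p.1) (t := D),
      Finset.sum_congr rfl hfib, ← Finset.sum_erase_add _ _ ht₀, hext, Finset.card_singleton]
    · apply Even.add_one
      apply Finset.even_sum
      intro t ht
      obtain ⟨htne, ht⟩ := Finset.mem_erase.1 ht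
      simp only [D, Finset.mem_filter, Finset.mem_univ, true_and] at ht
      obtain ⟨⟨him, hcard⟩, htd⟩ := ht
      -- Without genuine points the colours would force `t = t₀`. A genuine `w` lies below the slack
      -- point `k` for every index other than `k`, which gives the room that `card_extensions`
      -- needs.
      obtain ⟨w, hw⟩ : ∃ w, Sum.inl w ∈ t := by
        by_contra! h
        apply htne
        ext (w | j)
        · simp [h w, hinl w]
        · rw [hinr]
          constructor
          · intro hj
            have : c' (Sum.inr j) ∈ t.image c' := Finset.mem_image_of_mem _ hj
            rw [him] at this
            simpa [hc'] using this
          · intro hj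
            have : j ∈ t.image c' := by rw [him]; simpa using hj
            obtain ⟨x | k, hx, hxj⟩ := Finset.mem_image.1 this
            · exact absurd hx (h x)
            · simp only [hc', Sum.elim_inr, id] at hxj
              exact hxj ▸ hx
      rw [htd.card_extensions hr ⟨_, hw⟩ hcard
        fun k => ⟨Sum.inr k, fun l hl => ⟨Sum.inl w, hw, hhigh l k w hl.symm⟩⟩]
      exact even_two
    · rintro ⟨t, y⟩ h
      simp only [P, D, Finset.coe_filter, Finset.mem_univ, true_and, Set.mem_ofPred_eq] at h ⊢
      exact ⟨h.2.1, h.2.2.mono (Finset.subset_insert _ _)⟩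
  exact (Nat.not_even_iff_odd.2 hodd) heven

/-- A finite family in a linear order can be ranked injectively by natural numbers, compatibly with
the order. -/
theorem exists_injective_rank {T R : Type*} [Fintype T] [LinearOrder R] (g : T → R) :
    ∃ f : T → ℕ, Function.Injective f ∧ (∀ v w, f v ≤ f w → g v ≤ g w) ∧
      ∀ v, f v < Fintype.card T := by
  classical
  let e := Fintype.equivFin T
  let k : T → R ×ₗ Fin (Fintype.card T) := fun v => toLex (g v, e v)
  have hk : Function.Injective k := fun v w h =>
    e.injective (congrArg Prod.snd (toLex.injective h))
  let f : T → ℕ := fun v => (Finset.univ.filter fun w => k w < k v).card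
  have hlt : ∀ v w, k v < k w → f v < f w := by
    intro v w h
    apply Finset.card_lt_card
    refine Finset.ssubset_iff_of_subset ?_ |>.2 ⟨v, by simpa using h, by simp⟩
    intro x hx
    simp only [Finset.mem_filter, Finset.mem_univ, true_and] at hx ⊢
    exact hx.trans h
  refine ⟨f, fun v w h => ?_, fun v w h => ?_, fun v => ?_⟩
  · rcases lt_trichotomy (k v) (k w) with h' | h' | h'
    · exact absurd h (hlt _ _ h').ne
    · exact hk h'
    · exact absurd h (hlt _ _ h').ne'
  · by_contra! h'
    exact absurd h (not_le.2 (hlt w v (Prod.Lex.toLex_lt_toLex.2 (Or.inl h'))))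
  · exact Finset.card_lt_univ_of_notMem (x := v) (by simp)

/-- **Scarf's lemma** for a finite coloured set with a family of real-valued functions. -/
theorem exists_scarf {T I R : Type*} [Fintype T] [Nonempty T] [Fintype I] [Nonempty I]
    [LinearOrder R] (g : I → T → R) (c : T → I) :
    ∃ (σ : Finset T) (C : Finset I), (∀ i ∈ C, ∃ x ∈ σ, c x = i) ∧
      ∀ y, ∃ i ∈ C, ∀ x ∈ σ, g i y ≤ g i x := by
  classical
  choose f hf hfg hfT using fun i => exists_injective_rank (g i)
  let e := Fintype.equivFin I
  -- Genuine ranks are shifted by 1 to leave rank 0 to the index's own slack point; the other slack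
  -- points go on top.
  let r : I → T ⊕ I → ℕ := fun i => Sum.elim (fun v => f i v + 1)
    fun j => if j = i then 0 else Fintype.card T + 1 + e j
  have hr : ∀ i, Function.Injective (r i) := by
    rintro i (v | j) (w | k) h
    · exact congrArg _ (hf i (by simpa [r] using h))
    · have := hfT i v
      simp only [r, Sum.elim_inl, Sum.elim_inr] at h
      grind
    · have := hfT i w
      simp only [r, Sum.elim_inl, Sum.elim_inr] at h
      grind
    · simp only [r, Sum.elim_inr] at h
      split_ifs at h with h1 h2 h2
      · rw [h1, h2]
      · omega
      · omega
      · exact congrArg _ (e.injective (Fin.ext (by omega)))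
  obtain ⟨s, hs, hsc⟩ := exists_dominant_image_eq_univ r hr (by intro i x; simp [r])
    (by
      intro i j v hj
      have := hfT i v
      simp only [r, Sum.elim_inl, Sum.elim_inr, if_neg hj]
      omega) c
  refine ⟨Finset.univ.filter fun v => Sum.inl v ∈ s, Finset.univ.filter fun i => Sum.inr i ∉ s,
    fun i hi => ?_, fun y => ?_⟩
  · simp only [Finset.mem_filter, Finset.mem_univ, true_and] at hi ⊢
    have : i ∈ s.image (Sum.elim c id) := by rw [hsc]; exact Finset.mem_univ _
    obtain ⟨x | j, hx, hxi⟩ := Finset.mem_image.1 this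
    · exact ⟨x, hx, hxi⟩
    · exact absurd ((show j = i from hxi) ▸ hx) hi
  -- The index that dominates a genuine point cannot have its own slack point in `s`, since that
  -- point has rank 0. Hence it lies in `C`.
  · obtain ⟨i, hi⟩ := hs (Sum.inl y)
    refine ⟨i, ?_, fun x hx => ?_⟩
    · simp only [Finset.mem_filter, Finset.mem_univ, true_and]
      intro h
      simpa [r] using hi _ h
    · simp only [Finset.mem_filter, Finset.mem_univ, true_and] at hx
      exact hfg i y x (by simpa [r] using hi _ hx)

/-! ### The dual KKM theorem -/

theorem exists_le_zero_of_forall_pos {X : Type*} [TopologicalSpace X] [CompactSpace X]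
    [Nonempty X] {F : X → ℝ} (hF : Continuous F) (h : ∀ ε > 0, ∃ x, F x ≤ ε) :
    ∃ x, F x ≤ 0 := by
  obtain ⟨x, -, hx⟩ := isCompact_univ.exists_isMinOn Set.univ_nonempty hF.continuousOn
  refine ⟨x, le_of_forall_pos_le_add fun ε hε => ?_⟩
  obtain ⟨y, hy⟩ := h ε hε
  rw [zero_add]
  exact (hx (Set.mem_univ y)).trans hy

/-- If a finite set of points is `η`-dense in the simplex, then the lower bounds of a set that is
dominant for the coordinates in `C` almost add up to one. -/
theorem one_lt_sum_of_dominant {I : Type*} [Fintype I] [Nonempty I] {T : Set (stdSimplex ℝ I)}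
    {η : ℝ} (hη : 0 < η) (hT : ∀ y : stdSimplex ℝ I, ∃ z ∈ T, dist y z < η) {C : Finset I}
    {b : I → ℝ} (hb : ∀ i, 0 ≤ b i) (hC : ∀ y ∈ T, ∃ i ∈ C, y i ≤ b i) :
    1 < ∑ i, b i + Fintype.card I * η := by
  by_contra! hsum
  have hn : (0 : ℝ) < Fintype.card I := by exact_mod_cast Fintype.card_pos
  set s : ℝ := (1 - (∑ i, b i + Fintype.card I * η)) / Fintype.card I with hs
  have hs0 : 0 ≤ s := div_nonneg (by linarith) hn.le
  -- Spreading the missing mass evenly gives a point of the simplex exceeding `b` by at least η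
  -- everywhere; a point of `T` within η of it exceeds `b` in every coordinate.
  let y : stdSimplex ℝ I := ⟨fun i => b i + η + s, fun i => by have := hb i; positivity, by
    simp only [Finset.sum_add_distrib, Finset.sum_const, Finset.card_univ, nsmul_eq_mul]
    rw [hs]; field_simp; ring⟩
  obtain ⟨z, hz, hyz⟩ := hT y
  obtain ⟨i, -, hi⟩ := hC z hz
  have h1 : dist (y i) (z i) < η := (dist_le_pi_dist y.1 z.1 i).trans_lt hyz
  rw [Real.dist_eq] at h1
  have h2 := (abs_lt.1 h1).2
  have h3 : y i = b i + η + s := rfl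
  linarith

/-- Scarf's lemma on a fine net gives a set `σ` with coordinatewise lower bounds `b` of total almost
1, so all its points are close to `b` and to each other. Colours in `C` occur in `σ`, and uniform
continuity bounds their `g j`; for the others `b j = 0`, so the coordinate itself is small. -/
theorem exists_forall_min_le {I : Type*} [Fintype I] [Nonempty I]
    {g : I → stdSimplex ℝ I → ℝ} (hg : ∀ i, Continuous (g i)) (hcov : ∀ x, ∃ i, g i x ≤ 0)
    {ε : ℝ} (hε : 0 < ε) : ∃ x : stdSimplex ℝ I, ∀ j, min (x j) (g j x) ≤ ε := by
  classical
  have huc : UniformContinuous fun x : stdSimplex ℝ I => fun i => g i x :=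
    CompactSpace.uniformContinuous_of_continuous (continuous_pi hg)
  obtain ⟨δ, hδ, hδε⟩ := Metric.uniformContinuous_iff.1 huc ε hε
  have hn : (0 : ℝ) < Fintype.card I := by exact_mod_cast Fintype.card_pos
  -- The defect of `∑ i, b i` from 1 will be less than card I times η, which must not exceed δ or ε.
  set η : ℝ := min δ ε / Fintype.card I with hη
  have hη0 : 0 < η := div_pos (lt_min hδ hε) hn
  have hnη : Fintype.card I * η = min δ ε := by rw [hη]; field_simp
  obtain ⟨T, -, hTfin, hT⟩ := Metric.finite_approx_of_totallyBounded
    (isCompact_univ (X := stdSimplex ℝ I)).totallyBounded η hη0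
  have hT' : ∀ y : stdSimplex ℝ I, ∃ z ∈ T, dist y z < η := by
    intro y
    simpa using hT (Set.mem_univ y)
  have : Fintype T := hTfin.fintype
  have : Nonempty T := by
    obtain ⟨z, hz, -⟩ := hT' (Classical.arbitrary _)
    exact ⟨⟨z, hz⟩⟩
  choose c hc using hcov
  obtain ⟨σ, C, hσC, hdom⟩ := exists_scarf (fun i (x : T) => x.1 i) (fun x : T => c x.1)
  obtain ⟨i₀, hi₀, -⟩ := hdom (Classical.arbitrary T)
  obtain ⟨x₀, hx₀, -⟩ := hσC i₀ hi₀
  choose m hm hmin using fun i => σ.exists_min_image (fun x : T => x.1 i) ⟨x₀, hx₀⟩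
  let b : I → ℝ := fun i => if i ∈ C then (m i).1 i else 0
  have hbx : ∀ x ∈ σ, ∀ i, b i ≤ x.1 i := by
    intro x hx i
    by_cases hi : i ∈ C
    · simpa [b, hi] using hmin i x hx
    · simp [b, hi]
  have hb : 1 < ∑ i, b i + Fintype.card I * η := by
    refine one_lt_sum_of_dominant hη0 hT' (C := C) (fun i => ?_) fun y hy => ?_
    · by_cases hi : i ∈ C <;> simp [b, hi]
    · obtain ⟨i, hi, h⟩ := hdom ⟨y, hy⟩
      exact ⟨i, hi, by simpa [b, hi] using h _ (hm i)⟩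
  have hxb : ∀ x ∈ σ, ∀ i, x.1 i - b i < min δ ε := by
    intro x hx i
    have h1 : x.1 i - b i ≤ ∑ i, (x.1 i - b i) := Finset.single_le_sum
      (f := fun i => x.1 i - b i) (fun i _ => sub_nonneg.2 (hbx x hx i)) (Finset.mem_univ i)
    rw [Finset.sum_sub_distrib, stdSimplex.sum_eq_one] at h1
    linarith
  refine ⟨x₀.1, fun j => ?_⟩
  by_cases hj : j ∈ C
  · obtain ⟨z, hz, rfl⟩ := hσC j hj
    have hdist : dist x₀.1 z.1 < δ := by
      refine (dist_pi_lt_iff hδ).2 fun i => ?_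
      change dist (x₀.1 i) (z.1 i) < δ
      rw [Real.dist_eq, abs_lt]
      have h1 := hbx x₀ hx₀ i
      have h2 := hbx z hz i
      have h3 := hxb x₀ hx₀ i
      have h4 := hxb z hz i
      have h5 := min_le_left δ ε
      constructor <;> linarith
    have h1 := (dist_le_pi_dist _ _ (c z.1)).trans_lt (hδε hdist)
    rw [Real.dist_eq] at h1
    exact (min_le_right _ _).trans (by linarith [hc z.1, (abs_lt.1 h1).2])
  · have h1 := hxb x₀ hx₀ j
    simp only [b, hj, if_false, sub_zero] at h1
    exact (min_le_left _ _).trans (h1.le.trans (min_le_right _ _))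

/-- Dual form of the **Knaster–Kuratowski–Mazurkiewicz theorem**: if the closed sets `g i ≤ 0`
cover the simplex, some point lies in all the sets belonging to its positive coordinates. -/
theorem exists_forall_pos_imp_le_zero {I : Type*} [Fintype I] [Nonempty I]
    {g : I → stdSimplex ℝ I → ℝ} (hg : ∀ i, Continuous (g i)) (hcov : ∀ x, ∃ i, g i x ≤ 0) :
    ∃ x : stdSimplex ℝ I, ∀ j, 0 < x j → g j x ≤ 0 := by
  have hcoord : ∀ j, Continuous fun x : stdSimplex ℝ I => x j := fun j =>
    (continuous_apply j).comp continuous_subtype_val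
  obtain ⟨x, hx⟩ := exists_le_zero_of_forall_pos
    (F := fun x : stdSimplex ℝ I => Finset.univ.sup' Finset.univ_nonempty
      fun j => min (x j) (g j x))
    (Continuous.finset_sup'_apply _ fun j _ => (hcoord j).min (hg j))
    fun ε hε => (exists_forall_min_le hg hcov hε).imp fun x hx =>
      Finset.sup'_le _ _ fun j _ => hx j
  refine ⟨x, fun j hj => ?_⟩
  have := (Finset.sup'_le_iff _ _).1 hx j (Finset.mem_univ j)
  exact (min_le_iff.1 this).resolve_left (not_le.2 hj)

/-! ### Doubly stochastic matrices and the main theorem -/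

/-- By Birkhoff, `M` is a convex combination of permutation matrices; any permutation of positive
weight serves. -/
theorem exists_perm_pos_of_mem_doublyStochastic {I : Type*} [Fintype I] [DecidableEq I]
    {M : Matrix I I ℝ} (hM : M ∈ doublyStochastic ℝ I) :
    ∃ π : Equiv.Perm I, ∀ i, 0 < M i (π i) := by
  obtain ⟨w, hw, hw1, rfl⟩ := exists_eq_sum_perm_of_mem_doublyStochastic hM
  obtain ⟨π, -, hπ⟩ := Finset.exists_lt_of_sum_lt
    (s := (Finset.univ : Finset (Equiv.Perm I))) (f := fun _ => 0) (g := w) (by simp [hw1])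
  refine ⟨π, fun i => ?_⟩
  rw [Matrix.sum_apply]
  refine Finset.sum_pos' (fun τ _ => ?_) ⟨π, Finset.mem_univ _, ?_⟩
  · simp only [Matrix.smul_apply, PEquiv.toMatrix_apply]
    split_ifs <;> simp [hw]
  · simpa [PEquiv.toMatrix_apply, Equiv.toPEquiv_apply] using hπ

theorem exists_perm_le_add {I : Type*} [Fintype I] [Nonempty I]
    {F : I → I → stdSimplex ℝ I → ℝ} (hF : ∀ i j, Continuous (F i j))
    (hnonneg : ∀ i j x, 0 ≤ F i j x) (hsum : ∀ i x, ∑ j, F i j x = 1) {ε : ℝ} (hε : 0 < ε) :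
    ∃ (x : stdSimplex ℝ I) (π : Equiv.Perm I), ∀ i, F i (π i) x ≤ x (π i) + ε := by
  classical
  have hcoord : ∀ j, Continuous fun x : stdSimplex ℝ I => x j := fun j =>
    (continuous_apply j).comp continuous_subtype_val
  -- The factor `1 + ε` makes each unclipped row add up to ε, which keeps the normalising sums `S`
  -- away from zero.
  let p : I → I → stdSimplex ℝ I → ℝ := fun i j x => max 0 ((1 + ε) * x j - F i j x)
  let S : I → stdSimplex ℝ I → ℝ := fun i x => ∑ j, p i j x
  have hp : ∀ i j, Continuous (p i j) := fun i j =>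
    continuous_const.max (((hcoord j).const_mul _).sub (hF i j))
  have hp0 : ∀ i j x, 0 ≤ p i j x := fun i j x => le_max_left _ _
  have hS : ∀ i x, 0 < S i x := by
    intro i x
    calc 0 < ε := hε
      _ = ∑ j, ((1 + ε) * x j - F i j x) := by
        rw [Finset.sum_sub_distrib, ← Finset.mul_sum, stdSimplex.sum_eq_one, hsum]; ring
      _ ≤ S i x := Finset.sum_le_sum fun j _ => le_max_right _ _
  let M : stdSimplex ℝ I → Matrix I I ℝ := fun x i j => p i j x / S i x
  have hM0 : ∀ x i j, 0 ≤ M x i j := fun x i j => div_nonneg (hp0 i j x) (hS i x).le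
  have hrow : ∀ x i, ∑ j, M x i j = 1 := fun x i => by
    simp only [M]
    rw [← Finset.sum_div, div_self (hS i x).ne']
  have htotal : ∀ x, ∑ j, ∑ i, M x i j = ∑ _j : I, (1 : ℝ) := fun x => by
    rw [Finset.sum_comm]
    exact Finset.sum_congr rfl fun i _ => hrow x i
  obtain ⟨x, hx⟩ := exists_forall_pos_imp_le_zero (g := fun j x => ∑ i, M x i j - 1)
    (fun j => (continuous_finsetSum _ fun i _ => (hp i j).div
      (continuous_finsetSum _ fun j _ => hp i j) fun x => (hS i x).ne').sub continuous_const)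
    fun x => by
      obtain ⟨j, -, hj⟩ := Finset.exists_le_of_sum_le Finset.univ_nonempty (htotal x).le
      exact ⟨j, sub_nonpos.2 hj⟩
  have hcol_le : ∀ j, ∑ i, M x i j ≤ 1 := by
    intro j
    -- KKM says nothing about j with `x j = 0`, but there nonnegativity of `F` makes every entry of
    -- the column zero.
    rcases (stdSimplex.zero_le x j).eq_or_lt with h | h
    · have : ∀ i, M x i j = 0 := fun i => by
        have : p i j x = 0 := max_eq_left (by rw [← h]; simpa using hnonneg i j x)
        simp [M, this]
      simp [this]
    · exact sub_nonpos.1 (hx j h)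
  have hcol : ∀ j, ∑ i, M x i j = 1 := fun j =>
    (Finset.sum_eq_sum_iff_of_le fun j _ => hcol_le j).1 (htotal x) j (Finset.mem_univ j)
  obtain ⟨π, hπ⟩ := exists_perm_pos_of_mem_doublyStochastic
    (mem_doublyStochastic_iff_sum.2 ⟨hM0 x, hrow x, hcol⟩)
  refine ⟨x, π, fun i => ?_⟩
  have h1 : 0 < p i (π i) x := by
    have := mul_pos (hπ i) (hS i x)
    simpa [M, (hS i x).ne'] using this
  have h2 := (lt_max_iff.1 h1).resolve_left (lt_irrefl _)
  nlinarith [stdSimplex.le_one x (π i)]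

/-- A continuous family of stochastic matrices over the simplex has, at some point, a permutation
along which its entries are bounded by the coordinates of the point. -/
theorem exists_perm_le {I : Type*} [Fintype I] [Nonempty I]
    {F : I → I → stdSimplex ℝ I → ℝ} (hF : ∀ i j, Continuous (F i j))
    (hnonneg : ∀ i j x, 0 ≤ F i j x) (hsum : ∀ i x, ∑ j, F i j x = 1) :
    ∃ (x : stdSimplex ℝ I) (π : Equiv.Perm I), ∀ i, F i (π i) x ≤ x (π i) := by
  classical
  have hcoord : ∀ j, Continuous fun x : stdSimplex ℝ I => x j := fun j =>
    (continuous_apply j).comp continuous_subtype_val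
  -- The minimum over permutations of the worst violation is continuous, so the limit ε → 0 needs no
  -- choice of a constant permutation.
  obtain ⟨x, hx⟩ := exists_le_zero_of_forall_pos
    (F := fun x : stdSimplex ℝ I => (Finset.univ : Finset (Equiv.Perm I)).inf'
      Finset.univ_nonempty fun π => Finset.univ.sup' Finset.univ_nonempty
        fun i => F i (π i) x - x (π i))
    (Continuous.finset_inf'_apply _ fun π _ => Continuous.finset_sup'_apply _
      fun i _ => (hF i (π i)).sub (hcoord (π i)))
    fun ε hε => by
      obtain ⟨x, π, h⟩ := exists_perm_le_add hF hnonneg hsum hε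
      exact ⟨x, (Finset.inf'_le_iff _).2 ⟨π, Finset.mem_univ _,
        Finset.sup'_le _ _ fun i _ => by linarith [h i]⟩⟩
  obtain ⟨π, -, hπ⟩ := (Finset.inf'_le_iff _).1 hx
  exact ⟨x, π, fun i => sub_nonpos.1 ((Finset.sup'_le_iff _ _).1 hπ i (Finset.mem_univ i))⟩

theorem mainTheorem8 (d : ℕ)
    (f : stdSimplex ℝ (Fin (d + 1)) → Matrix.rowStochastic ℝ (Fin (d + 1)))
    (hf : Continuous f) :
    (∃ (x : stdSimplex ℝ (Fin (d + 1))) (π : Equiv.Perm (Fin (d + 1))),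
      ∀ i : Fin (d + 1), (f x : Matrix (Fin (d + 1)) (Fin (d + 1)) ℝ) i (π i) ≤ x (π i)) ∧
    (∀ h : stdSimplex ℝ (Fin (d + 1)) → stdSimplex ℝ (Fin (d + 1)),
      (∀ x i j, (f x : Matrix (Fin (d + 1)) (Fin (d + 1)) ℝ) i j = h x j) →
        (∀ x, (∃ π : Equiv.Perm (Fin (d + 1)), ∀ i : Fin (d + 1), (f x : Matrix (Fin (d + 1)) (Fin (d + 1)) ℝ) i (π i) ≤ x (π i)) ↔
          h x = x) ∧
        ∃ x, h x = x) := by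
  have hmain : ∃ (x : stdSimplex ℝ (Fin (d + 1))) (π : Equiv.Perm (Fin (d + 1))),
      ∀ i : Fin (d + 1), (f x : Matrix (Fin (d + 1)) (Fin (d + 1)) ℝ) i (π i) ≤ x (π i) :=
    exists_perm_le (F := fun i j x => (f x : Matrix (Fin (d + 1)) (Fin (d + 1)) ℝ) i j)
      (fun i j => (continuous_subtype_val.comp hf).matrix_elem i j)
      (fun i j x => Matrix.nonneg_of_mem_rowStochastic (f x).2)
      (fun i x => Matrix.sum_row_of_mem_rowStochastic (f x).2 i)
  refine ⟨hmain, fun h hh => ?_⟩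
  have hiff : ∀ x, (∃ π : Equiv.Perm (Fin (d + 1)), ∀ i : Fin (d + 1),
      (f x : Matrix (Fin (d + 1)) (Fin (d + 1)) ℝ) i (π i) ≤ x (π i)) ↔ h x = x := by
    refine fun x => ⟨?_, fun hx => ⟨1, fun i => by rw [hh, hx]⟩⟩
    rintro ⟨π, hπ⟩
    -- With equal rows the permutation only reorders the inequalities, and two points of the simplex
    -- comparable in every coordinate coincide.
    have hle : ∀ j, h x j ≤ x j := fun j => by
      have := hπ (π.symm j)
      rwa [hh, π.apply_symm_apply] at this
    ext j
    exact (Finset.sum_eq_sum_iff_of_le fun j _ => hle j).1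
      (by rw [stdSimplex.sum_eq_one, stdSimplex.sum_eq_one]) j (Finset.mem_univ j)
  obtain ⟨x, hx⟩ := hmain
  exact ⟨hiff, x, (hiff x).1 hx⟩
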